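/- Let $p\colon\mathbb R^n\to[1,\infty)$ be a measurable function such that $p^-:=\operatorname{ess\,inf}_{\mathbb R^n}p>1$, $p^+:=\operatorname{ess\,sup}_{\mathbb R^n}p<\infty$, and $1/p$ is log-Hölder continuous, i.e. for some constant $L>0$ we have $\left|\frac1{p(x)}-\frac1{p(y)}\right|\le \frac{L}{\log(e+1/|x-y|)}$ for all $x\neq y$ in $\mathbb R^n$. Let $\mathcal A\colon\mathbb R^n\times\mathbb R\times\mathbb R^n\to\mathbb R^n$ be a Carathéodory function (measurable in the first argument, continuous in the last two jointly) for which there are measurable functions $a,b\colon\mathbb R^n\to\mathbb R$ and constants $a_->0$, $b^+<\infty$ with $a_-\le a\le b\le b^+$ such that, for all $(x,t,\xi)\in\mathbb R^n\times\mathbb R\times\mathbb R^n$, $$\langle\mathcal A(x,t,\xi),\xi\rangle\ge a(x)|\xi|^{p(x)},\qquad |\mathcal A(x,t,\xi)|\le b(x)|\xi|^{p(x)-1}.$$ Let $f\colon\mathbb R\to[0,\infty)$ be continuous. A function $u\in W^{1,p(\cdot)}_{\mathrm{loc}}(\mathbb R^n)$ is called a supersolution of $\operatorname{div}\mathcal A(x,u,\nabla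 u)= f(u)$ in $\mathbb R^n$ if $$-\int_{\mathbb R^n}\langle\mathcal A(x,u,\nabla u),\nabla\varphi\rangle\,dx\ \ge\ \int_{\mathbb R^n}f(u)\,\varphi\,dx\qquad\text{for all nonnegative }\varphi\in C_0^\infty(\mathbb R^n),$$ where both integrals converge. Here $W^{1,p(\cdot)}_{\mathrm{loc}}(\mathbb R^n)$ consists of the functions $u$ that, together with their distributional gradient $\nabla u$, belong to $L^{p(\cdot)}(K)$ for every compact $K\subset\mathbb R^n$, where $v\in L^{p(\cdot)}(K)$ means that $v$ is measurable on $K$ and $\int_K|v(x)/\mu|^{p(x)}\,dx<\infty$ for some $\mu>0$. Suppose that $p^->n$, that $f$ is strictly convex, and that $f(t)\ne0$ for all $t\in\mathbb R$. Then there exists no (essentially) bounded supersolution of $\operatorname{div}\mathcal A(x,u,\nabla u)= f(u)$ in $\mathbb R^n$. -/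

import Mathlib

open MeasureTheory
open scoped ContDiff

noncomputable section

namespace NonstandardGrowth

/-- The Euclidean space `ℝⁿ`. -/
abbrev Rn (n : ℕ) : Type := EuclideanSpace ℝ (Fin n)

/-- Global log-Hölder continuity on `ℝⁿ`:
`|α(x) - α(y)| ≤ L / log (e + 1/|x-y|)`. For `x = y` the condition is void. -/
def IsLogHolder {n : ℕ} (α : Rn n → ℝ) : Prop :=
  ∃ L : ℝ, 0 < L ∧ ∀ x y : Rn n,
    |α x - α y| ≤ L / Real.log (Real.exp 1 + 1 / ‖x - y‖)

/-- `p⁻`, the essential infimum of `p` over `ℝⁿ` with respect to Lebesgue measure. -/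
def expInf {n : ℕ} (p : Rn n → ℝ) : ℝ := essInf p volume

/-- Bounded log-Hölder continuous variable exponents on `ℝⁿ`: measurable `p ≥ 1` with
`1 < p⁻ ≤ p⁺ < ∞` and `1/p` log-Hölder continuous. (`AEMeasurable` with respect to `volume` is
Lebesgue measurability.) -/
structure IsExponent {n : ℕ} (p : Rn n → ℝ) : Prop where
  aemeasurable : AEMeasurable p volume
  one_le : ∀ x, 1 ≤ p x
  one_lt_expInf : 1 < expInf p
  essBounded : ∃ P : ℝ, ∀ᵐ x ∂(volume : Measure (Rn n)), p x ≤ P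
  logHolder : IsLogHolder (fun x => 1 / p x)

/-- The modular `∫_S |v(x)|^{p(x)} dx`, with values in `[0, ∞]`. -/
def modular {n : ℕ} {F : Type*} [NormedAddCommGroup F] (p : Rn n → ℝ) (S : Set (Rn n))
    (v : Rn n → F) : ENNReal :=
  ∫⁻ x in S, ENNReal.ofReal (‖v x‖ ^ p x)

/-- `v ∈ L^{p(·)}(S)`: `v` is measurable on `S` and the modular of `v / μ` is finite for some
`μ > 0`. -/
def MemLpVar {n : ℕ} {F : Type*} [NormedAddCommGroup F] [NormedSpace ℝ F]
    (p : Rn n → ℝ) (S : Set (Rn n)) (v : Rn n → F) : Prop :=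
  AEStronglyMeasurable v (volume.restrict S) ∧
    ∃ μ : ℝ, 0 < μ ∧ modular p S (fun x => μ⁻¹ • v x) < ⊤

/-- `φ ∈ C₀^∞(ℝⁿ)`. -/
def IsTest {n : ℕ} (φ : Rn n → ℝ) : Prop :=
  ContDiff ℝ ∞ φ ∧ HasCompactSupport φ

/-- `G` is the distributional gradient of `u` on `ℝⁿ`. -/
def HasWeakGradient {n : ℕ} (u : Rn n → ℝ) (G : Rn n → Rn n) : Prop :=
  LocallyIntegrable u volume ∧ LocallyIntegrable G volume ∧
    ∀ φ : Rn n → ℝ, IsTest φ →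
      ∫ x, u x • gradient φ x = -∫ x, φ x • G x

/-- `u ∈ W^{1,p(·)}_loc(ℝⁿ)` with distributional gradient `G`: both `u` and `G` belong to
`L^{p(·)}(K)` for every compact set `K`. -/
def MemW1Loc {n : ℕ} (p : Rn n → ℝ) (u : Rn n → ℝ) (G : Rn n → Rn n) : Prop :=
  HasWeakGradient u G ∧
    ∀ K : Set (Rn n), IsCompact K → MemLpVar p K u ∧ MemLpVar p K G

/-- Carathéodory functions `ℝⁿ × ℝ × ℝⁿ → ℝⁿ`: Lebesgue measurable in the first argument and
(jointly) continuous in the last two. -/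
def IsCaratheodory {n : ℕ} (A : Rn n → ℝ → Rn n → Rn n) : Prop :=
  (∀ t ξ, AEMeasurable (fun x => A x t ξ) volume) ∧
    ∀ x, Continuous (fun q : ℝ × Rn n => A x q.1 q.2)

/-- Carathéodory functions of nonstandard growth, i.e. of `p(·)`-growth. -/
def HasGrowth {n : ℕ} (p : Rn n → ℝ) (A : Rn n → ℝ → Rn n → Rn n) : Prop :=
  IsCaratheodory A ∧
    ∃ a b : Rn n → ℝ, AEMeasurable a volume ∧ AEMeasurable b volume ∧
      (∃ aMinus : ℝ, 0 < aMinus ∧ ∀ x, aMinus ≤ a x) ∧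
      (∀ x, a x ≤ b x) ∧
      (∃ bPlus : ℝ, ∀ x, b x ≤ bPlus) ∧
      (∀ x t ξ, a x * ‖ξ‖ ^ p x ≤ inner ℝ (A x t ξ) ξ) ∧
      (∀ x t ξ, ‖A x t ξ‖ ≤ b x * ‖ξ‖ ^ (p x - 1))

/-- `u ∈ W^{1,p(·)}_loc(ℝⁿ)` is a supersolution of `div A(x, u, ∇u) = f(u)`, that is, a weak
solution of `div A(x, u, ∇u) ≥ f(u)`:
`-∫ ⟨A(x, u, ∇u), ∇φ⟩ ≥ ∫ f(u) φ` for all nonnegative `φ ∈ C₀^∞(ℝⁿ)`, both integrals being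
convergent. -/
def IsSupersolution {n : ℕ} (p : Rn n → ℝ) (A : Rn n → ℝ → Rn n → Rn n) (f : ℝ → ℝ)
    (u : Rn n → ℝ) : Prop :=
  ∃ G : Rn n → Rn n, MemW1Loc p u G ∧
    ∀ φ : Rn n → ℝ, IsTest φ → (∀ x, 0 ≤ φ x) →
      Integrable (fun x => inner ℝ (A x (u x) (G x)) (gradient φ x)) volume ∧
      Integrable (fun x => f (u x) * φ x) volume ∧
      ∫ x, f (u x) * φ x ≤ -∫ x, inner ℝ (A x (u x) (G x)) (gradient φ x)

end NonstandardGrowth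

end

/-! Since `f` is continuous and positive, a bound |u| ≤ M gives f(u) ≥ c > 0 almost everywhere.
Write h = A(x, u, ∇u) and test with (u + 2M)ζ, where ζ is a power of a cutoff η equal to 1 on B_R
and with |∇η| ≤ C/R. The factor u + 2M lies between M and 3M, so cM ∫ζ + ∫ ζ⟨h, ∇u⟩ ≤ 3M ∫ |∇ζ||h|.
By coercivity the second integral dominates a∫ζ|∇u|^p, which absorbs the right side up to an error
(K/R)|B_2R| (`mul_rpow_mul_pow_le`). Hence cM|B_R| ≤ 2ⁿ(K/R)|B_R| for all large R
(`exists_mul_measure_le`), which fails as R → ∞.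

The technical point is that u is not smooth. It is replaced in the test function by mollifications
uₖ, which satisfy the same bounds, so the right side does not depend on k. In the limit only an
upper bound for ∫ζ⟨h, ∇u⟩ is needed, and Fatou's lemma gives it (`integral_inner_le_of_mollify`).
The required majorant comes from the log-Hölder estimate |ρ∗G|^{p(x)} ≤ C ρ∗(1 + |G|^p) of
`norm_rpow_convolution_le`. -/

namespace NonstandardGrowth

open Filter Topology Metric Convolution ContinuousLinearMap

variable {n : ℕ}

/-! ### Continuity and boundedness of the exponent -/

section Exponent

variable {p : Rn n → ℝ}

lemma log_exp_one_add_inv_tendsto {x : Rn n} :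
    Tendsto (fun y : Rn n => Real.log (Real.exp 1 + 1 / ‖y - x‖)) (𝓝[≠] x) atTop := by
  have h1 : Tendsto (fun y : Rn n => ‖y - x‖) (𝓝[≠] x) (𝓝[>] 0) := tendsto_norm_sub_self_nhdsNE x
  have h2 := tendsto_inv_nhdsGT_zero.comp h1
  refine Real.tendsto_log_atTop.comp (tendsto_atTop_add_const_left _ _ ?_)
  simpa [Function.comp_def] using h2

lemma IsLogHolder.continuous {α : Rn n → ℝ} (h : IsLogHolder α) : Continuous α := by
  obtain ⟨L, hL, h⟩ := h
  rw [continuous_iff_continuousAt]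
  intro x
  rw [continuousAt_iff_punctured_nhds, tendsto_iff_dist_tendsto_zero]
  have h0 : Tendsto (fun y : Rn n => L / Real.log (Real.exp 1 + 1 / ‖y - x‖)) (𝓝[≠] x) (𝓝 0) :=
    log_exp_one_add_inv_tendsto.const_div_atTop L
  refine squeeze_zero (fun _ => dist_nonneg) (fun y => ?_) h0
  simpa [Real.dist_eq] using h y x

lemma IsExponent.continuous (hp : IsExponent p) : Continuous p := by
  have h := hp.logHolder.continuous
  have h1 : p = fun x => (1 / p x)⁻¹ := by
    ext x
    simp
  rw [h1]
  refine h.inv₀ fun x => ?_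
  have := hp.one_le x
  positivity

/-- By continuity of `p`, the almost everywhere bound holds on a closed dense set, hence everywhere.
-/
lemma IsExponent.exists_forall_le (hp : IsExponent p) : ∃ P : ℝ, 1 ≤ P ∧ ∀ x, p x ≤ P := by
  obtain ⟨P, hP⟩ := hp.essBounded
  have hd : Dense {x | p x ≤ P} := Measure.dense_of_ae hP
  have hc : IsClosed {x | p x ≤ P} := isClosed_le hp.continuous continuous_const
  have hall : ∀ x, p x ≤ P := fun x => by
    have : x ∈ closure {x | p x ≤ P} := hd x
    rwa [hc.closure_eq] at this
  exact ⟨P, (hp.one_le 0).trans (hall 0), hall⟩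

end Exponent

/-! ### Test functions, mollification and weak gradients -/

lemma isTest_normed (ρ : ContDiffBump (0 : Rn n)) : IsTest (ρ.normed volume) :=
  ⟨ρ.contDiff_normed, ρ.hasCompactSupport_normed⟩

lemma IsTest.comp_sub_left {φ : Rn n → ℝ} (hφ : IsTest φ) (x : Rn n) :
    IsTest (fun y => φ (x - y)) :=
  ⟨hφ.1.comp (contDiff_const.sub contDiff_id),
    hφ.2.comp_homeomorph (Homeomorph.subLeft x)⟩

lemma IsTest.continuous_gradient {φ : Rn n → ℝ} (hφ : IsTest φ) : Continuous (gradient φ) :=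
  (InnerProductSpace.toDual ℝ (Rn n)).symm.continuous.comp
    (hφ.1.continuous_fderiv (by simp))

lemma IsTest.hasCompactSupport_gradient {φ : Rn n → ℝ} (hφ : IsTest φ) :
    HasCompactSupport (gradient φ) :=
  (hφ.2.fderiv ℝ).comp_left (g := (InnerProductSpace.toDual ℝ (Rn n)).symm) (map_zero _)

lemma IsTest.gradient_comp_sub_left {φ : Rn n → ℝ} (hφ : IsTest φ) (x y : Rn n) :
    gradient (fun y => φ (x - y)) y = -gradient φ (x - y) := by
  have h1 : HasFDerivAt (fun y : Rn n => x - y) (-ContinuousLinearMap.id ℝ (Rn n)) y :=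
    (hasFDerivAt_id y).const_sub x
  have h2 := ((hφ.1.differentiable (by simp)) (x - y)).hasFDerivAt.comp y h1
  refine ext_inner_right ℝ fun v => ?_
  rw [inner_neg_left, inner_gradient_left, inner_gradient_left]
  rw [show (fun y => φ (x - y)) = φ ∘ fun y => x - y from rfl, h2.fderiv]
  simp

/-- Mollification commutes with the weak gradient. -/
lemma HasWeakGradient.hasFDerivAt_convolution {u : Rn n → ℝ} {G : Rn n → Rn n}
    (h : HasWeakGradient u G) {ρ : Rn n → ℝ} (hρ : IsTest ρ) (x : Rn n) :
    HasFDerivAt (ρ ⋆[lsmul ℝ ℝ, volume] u : Rn n → ℝ)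
      (innerSL ℝ ((ρ ⋆[lsmul ℝ ℝ, volume] G : Rn n → Rn n) x)) x := by
  obtain ⟨hu, hG, hw⟩ := h
  have h1 := hρ.2.hasFDerivAt_convolution_right (lsmul ℝ ℝ : ℝ →L[ℝ] ℝ →L[ℝ] ℝ).flip hu
    (hρ.1.of_le (by simp)) x
  rw [convolution_flip] at h1
  refine h1.congr_fderiv (ContinuousLinearMap.ext fun v => Eq.symm ?_)
  rw [convolution_precompR_apply _ hu (hρ.2.fderiv ℝ) (hρ.1.continuous_fderiv (by simp)),
    convolution_lsmul_swap, convolution_def]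
  -- With the derivative placed on ρ, the weak gradient identity is tested with y ↦ ρ(x - y); the
  -- reflection accounts for the sign.
  have h2 := hw _ (hρ.comp_sub_left x)
  have hint1 : Integrable (fun t => ρ (x - t) • G t) volume :=
    hG.integrable_smul_left_of_hasCompactSupport (hρ.comp_sub_left x).1.continuous
      (hρ.comp_sub_left x).2
  have hint2 : Integrable (fun t => u t • gradient (fun y => ρ (x - y)) t) volume :=
    hu.integrable_smul_right_of_hasCompactSupport (hρ.comp_sub_left x).continuous_gradient
      (hρ.comp_sub_left x).hasCompactSupport_gradient
  rw [← neg_eq_iff_eq_neg] at h2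
  rw [← h2, innerSL_apply_apply, inner_neg_left, real_inner_comm, ← integral_inner hint2,
    ← integral_neg]
  refine integral_congr_ae (.of_forall fun t => ?_)
  simp only [hρ.gradient_comp_sub_left, inner_smul_right, inner_neg_right, flip_apply, lsmul_apply,
    smul_eq_mul]
  rw [real_inner_comm, inner_gradient_left]
  ring

/-- Mollification converges weakly in `L¹_loc`. -/
lemma tendsto_integral_mul_convolution {ι : Type*} {l : Filter ι}
    {ρ : ι → ContDiffBump (0 : Rn n)} (hρ : Tendsto (fun i => (ρ i).rOut) l (𝓝 0))
    {g ζ : Rn n → ℝ} (hg : LocallyIntegrable g volume) (hζ : Continuous ζ)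
    (hζc : HasCompactSupport ζ) :
    Tendsto (fun i => ∫ x, ζ x * ((ρ i).normed volume ⋆[lsmul ℝ ℝ, volume] g : Rn n → ℝ) x) l
      (𝓝 (∫ x, ζ x * g x)) := by
  -- ∫ ζ(ρ∗g) is the value at 0 of (ρ∗g)∗ζ' = ρ∗(g∗ζ'). Since g∗ζ' is continuous, pointwise
  -- convergence of mollifications at 0 suffices.
  set ζ' : Rn n → ℝ := fun x => ζ (-x)
  have hζ' : Continuous ζ' := hζ.comp continuous_neg
  have hζc' : HasCompactSupport ζ' := hζc.comp_homeomorph (Homeomorph.neg _)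
  have hgn : LocallyIntegrable (fun x => ‖g x‖) volume := fun x => (hg x).norm
  have hcont : Continuous (g ⋆[lsmul ℝ ℝ, volume] ζ' : Rn n → ℝ) :=
    hζc'.continuous_convolution_right _ hg hζ'
  have hcontn : Continuous ((fun x => ‖g x‖) ⋆[mul ℝ ℝ, volume] fun x => ‖ζ' x‖) :=
    hζc'.norm.continuous_convolution_right _ hgn hζ'.norm
  have key := ContDiffBump.convolution_tendsto_right_of_continuous (μ := volume) hρ hcont 0
  have e0 : ∀ k : Rn n → ℝ, (k ⋆[lsmul ℝ ℝ, volume] ζ' : Rn n → ℝ) 0 = ∫ x, ζ x * k x := by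
    intro k
    simp [convolution_def, ζ', mul_comm]
  rw [e0] at key
  refine key.congr fun i => ?_
  rw [← e0]
  refine (convolution_assoc (lsmul ℝ ℝ) (lsmul ℝ ℝ) (lsmul ℝ ℝ) (lsmul ℝ ℝ) ?_
    (ρ i).continuous_normed.aestronglyMeasurable hg.aestronglyMeasurable
    hζ'.aestronglyMeasurable ?_ ?_ ?_).symm
  · intro a b c
    simp [mul_assoc]
  · exact .of_forall fun y =>
      (ρ i).hasCompactSupport_normed.convolutionExists_left _ (ρ i).continuous_normed hg y
  · exact .of_forall fun y =>
      hζc'.norm.convolutionExists_right _ hgn hζ'.norm y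
  · exact (ρ i).hasCompactSupport_normed.norm.convolutionExists_left _
      (ρ i).continuous_normed.norm hcontn.locallyIntegrable 0

/-! ### Modular estimate for mollification under log-Hölder continuity -/

lemma le_add_rpow_mul_rpow {t c q s : ℝ} (ht : 0 ≤ t) (hc : 1 ≤ c) (hq : 1 ≤ q) (hqs : q ≤ s) :
    t ≤ c + c ^ (1 - q) * t ^ s := by
  rcases le_or_gt t c with h | h
  · have : 0 ≤ c ^ (1 - q) * t ^ s := by positivity
    linarith
  · have ht1 : 1 ≤ t := hc.trans h.le
    have ht0 : 0 < t := by linarith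
    have h1 : t ^ (1 - s) ≤ c ^ (1 - q) :=
      (Real.rpow_le_rpow_of_exponent_le ht1 (by linarith)).trans
        (Real.rpow_le_rpow_of_nonpos (by linarith) h.le (by linarith))
    have h2 : t = t ^ (1 - s) * t ^ s := by
      rw [← Real.rpow_add ht0]
      simp
    have h3 : t ^ (1 - s) * t ^ s ≤ c ^ (1 - q) * t ^ s := by gcongr
    linarith

/-- The level I^(1/q) makes the two terms of `h` equal, so N ≤ 2 I^(1/q). Raising to the power s
leaves the excess exponent s/q - 1 ≤ Pw. -/
lemma rpow_le_of_le_add {N I q s P w : ℝ} (hN : 0 ≤ N) (hI : 1 ≤ I) (hq : 0 < q) (hs : 1 ≤ s)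
    (hsP : s ≤ P) (hw : 0 ≤ w) (hqs : 1 / q ≤ 1 / s + w)
    (h : N ≤ I ^ (1 / q) + (I ^ (1 / q)) ^ (1 - q) * I) :
    N ^ s ≤ 2 ^ P * I ^ (P * w) * I := by
  have hI0 : 0 < I := by linarith
  have e1 : (I ^ (1 / q)) ^ (1 - q) * I = I ^ (1 / q) := by
    nth_rewrite 2 [← Real.rpow_one I]
    rw [← Real.rpow_mul hI0.le, ← Real.rpow_add hI0]
    congr 1
    field_simp
    ring
  have h2 : N ≤ 2 * I ^ (1 / q) := by linarith
  have h3 : s / q ≤ P * w + 1 := by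
    have : s * (1 / q) ≤ s * (1 / s + w) := by gcongr
    have e : s * (1 / s + w) = 1 + s * w := by field_simp
    have : s * w ≤ P * w := by gcongr
    have e' : s * (1 / q) = s / q := by ring
    linarith
  calc N ^ s ≤ (2 * I ^ (1 / q)) ^ s := by gcongr
    _ = 2 ^ s * I ^ (s / q) := by
      rw [Real.mul_rpow (by norm_num) (by positivity), ← Real.rpow_mul hI0.le]
      congr 2
      ring
    _ ≤ 2 ^ P * I ^ (P * w + 1) := by
      gcongr
      norm_num
    _ = 2 ^ P * I ^ (P * w) * I := by
      rw [Real.rpow_add_one hI0.ne']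
      ring

/-- With T = e + 1/(2r), one has r⁻¹ ≤ T², and T^(1/log T) = e. So a power of r⁻¹ with exponent of
order 1/log T stays bounded as r → 0; this is where the logarithmic modulus is used. -/
lemma rpow_log_le {I J r P L : ℝ} (hI : 0 ≤ I) (hJ : 1 ≤ J) (hr : 0 < r)
    (hP : 0 ≤ P) (hL : 0 ≤ L) (h : I ≤ J * (r⁻¹) ^ n) :
    I ^ (P * (L / Real.log (Real.exp 1 + 1 / (2 * r)))) ≤
      J ^ (P * L) * Real.exp (2 * n * (P * L)) := by
  set T := Real.exp 1 + 1 / (2 * r) with hT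
  have he : (2 : ℝ) ≤ Real.exp 1 := by linarith [Real.add_one_le_exp (1 : ℝ)]
  have hr2 : 0 < 1 / (2 * r) := by positivity
  have hT0 : 0 < T := by linarith
  have hlog : 1 ≤ Real.log T := by
    rw [Real.le_log_iff_exp_le hT0]
    linarith
  have hrT : r⁻¹ ≤ T ^ 2 := by
    have e : r⁻¹ = 2 * (1 / (2 * r)) := by
      field_simp
    rw [e, sq]
    have h1 : (2 : ℝ) ≤ T := by linarith
    have h2 : 1 / (2 * r) ≤ T := by linarith
    exact mul_le_mul h1 h2 hr2.le hT0.le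
  have hw : P * (L / Real.log T) ≤ P * L := by
    gcongr
    exact div_le_self hL hlog
  have hw0 : 0 ≤ P * (L / Real.log T) := by positivity
  calc I ^ (P * (L / Real.log T)) ≤ (J * (T ^ 2) ^ n) ^ (P * (L / Real.log T)) := by
        gcongr
        refine h.trans ?_
        gcongr
    _ = J ^ (P * (L / Real.log T)) * Real.exp (2 * n * (P * L)) := by
        rw [Real.mul_rpow (by positivity) (by positivity)]
        congr 1
        rw [Real.rpow_def_of_pos (by positivity), Real.log_pow, Real.log_pow]
        congr 1
        field_simp
        push_cast
        ring
    _ ≤ J ^ (P * L) * Real.exp (2 * n * (P * L)) := by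
        gcongr

lemma integrable_normed_smul {F : Type*} [NormedAddCommGroup F] [NormedSpace ℝ F]
    (ρ : ContDiffBump (0 : Rn n)) {g : Rn n → F} (hg : LocallyIntegrable g volume) (x : Rn n) :
    Integrable (fun t => ρ.normed volume (x - t) • g t) volume :=
  hg.integrable_smul_left_of_hasCompactSupport ((isTest_normed ρ).comp_sub_left x).1.continuous
    ((isTest_normed ρ).comp_sub_left x).2

lemma integral_normed_sub (ρ : ContDiffBump (0 : Rn n)) (x : Rn n) :
    ∫ t, ρ.normed volume (x - t) = 1 := by
  rw [integral_sub_left_eq_self (fun t => ρ.normed volume t) volume x, ρ.integral_normed]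

lemma dist_lt_of_normed_sub_ne_zero {ρ : ContDiffBump (0 : Rn n)} {x t : Rn n}
    (h : ρ.normed volume (x - t) ≠ 0) : ‖x - t‖ < ρ.rOut := by
  have : x - t ∈ Function.support (ρ.normed volume) := h
  rw [ρ.support_normed_eq] at this
  simpa using this

/-- A mollified locally integrable function is at most of order `r⁻ⁿ`, locally uniformly. -/
lemma convolution_normed_le {g : Rn n → ℝ} (hg : LocallyIntegrable g volume) (hg0 : ∀ x, 0 ≤ g x)
    (R : ℝ) : ∃ J : ℝ, 1 ≤ J ∧ ∀ ρ : ContDiffBump (0 : Rn n), ρ.rOut ≤ 1 → ∀ x ∈ ball (0 : Rn n) R,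
      (ρ.normed volume ⋆[lsmul ℝ ℝ, volume] g : Rn n → ℝ) x ≤ J * (ρ.rIn⁻¹) ^ n := by
  set κ : ℝ := volume.real (closedBall (0 : Rn n) 1)
  have hκ : 0 < κ :=
    ENNReal.toReal_pos (measure_closedBall_pos _ _ one_pos).ne' measure_closedBall_lt_top.ne
  -- For |x| < R and `rOut` ≤ 1 the kernel at x sees only this ball, and its height is at most
  -- 1/|B_rIn|.
  set B := closedBall (0 : Rn n) (R + 1)
  set S := ∫ t in B, g t
  have hS : 0 ≤ S := integral_nonneg hg0
  refine ⟨max 1 (κ⁻¹ * S), le_max_left _ _, fun ρ hρ x hx => ?_⟩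
  have hr := ρ.rIn_pos
  have hle : ∀ y, ρ.normed volume y ≤ κ⁻¹ * (ρ.rIn⁻¹) ^ n := fun y => by
    refine (ρ.normed_le_div_measure_closedBall_rIn volume y).trans_eq ?_
    rw [Measure.addHaar_real_closedBall' _ _ hr.le]
    simp only [finrank_euclideanSpace, Fintype.card_fin]
    rw [one_div, mul_inv, inv_pow, mul_comm]
  have hgB : IntegrableOn g B volume := hg.integrableOn_isCompact (isCompact_closedBall _ _)
  rw [convolution_lsmul_swap]
  have hbd : ∀ t, ρ.normed volume (x - t) • g t ≤
      B.indicator (fun t => κ⁻¹ * (ρ.rIn⁻¹) ^ n * g t) t := fun t => by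
    by_cases h : ρ.normed volume (x - t) = 0
    · rw [h, zero_smul]
      refine Set.indicator_nonneg (fun t _ => ?_) t
      have := hg0 t
      positivity
    · have h1 := dist_lt_of_normed_sub_ne_zero h
      have ht : t ∈ B := by
        have h2 : ‖x‖ < R := by simpa using hx
        have h3 : ‖t‖ ≤ ‖x‖ + ‖x - t‖ := by
          have := norm_sub_le x (x - t)
          simpa using this
        simp only [B, mem_closedBall, dist_zero_right]
        linarith
      rw [Set.indicator_of_mem ht, smul_eq_mul]
      exact mul_le_mul_of_nonneg_right (hle _) (hg0 t)
  calc ∫ t, ρ.normed volume (x - t) • g t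
      ≤ ∫ t, B.indicator (fun t => κ⁻¹ * (ρ.rIn⁻¹) ^ n * g t) t :=
        integral_mono (integrable_normed_smul ρ hg x)
          ((integrable_indicator_iff measurableSet_closedBall).2 (hgB.const_mul _)) hbd
    _ = κ⁻¹ * S * (ρ.rIn⁻¹) ^ n := by
        rw [integral_indicator measurableSet_closedBall, integral_const_mul]
        ring
    _ ≤ max 1 (κ⁻¹ * S) * (ρ.rIn⁻¹) ^ n := by
        gcongr
        exact le_max_right _ _

/-- Averages `le_add_rpow_mul_rpow` against the probability density `k`. A single lower exponent `q`
on the support of `k` suffices, and the level `c` stays free for later optimisation. -/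
lemma norm_integral_smul_le_add {α F : Type*} [MeasurableSpace α] {μ : Measure α}
    [NormedAddCommGroup F] [NormedSpace ℝ F] {G : α → F} {k p : α → ℝ} {c q : ℝ}
    (hk0 : ∀ t, 0 ≤ k t) (hk : Integrable k μ) (hk1 : ∫ t, k t ∂μ = 1)
    (hG : Integrable (fun t => k t • G t) μ)
    (hg : Integrable (fun t => k t • (1 + ‖G t‖ ^ p t)) μ) (hc : 1 ≤ c) (hq : 1 ≤ q)
    (hqp : ∀ t, k t ≠ 0 → q ≤ p t) :
    ‖∫ t, k t • G t ∂μ‖ ≤ c + c ^ (1 - q) * ∫ t, k t • (1 + ‖G t‖ ^ p t) ∂μ := by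
  have hbd : ∀ t, ‖k t • G t‖ ≤ k t * c + c ^ (1 - q) * (k t • (1 + ‖G t‖ ^ p t)) := fun t => by
    rw [norm_smul, smul_eq_mul, Real.norm_of_nonneg (hk0 t)]
    by_cases h : k t = 0
    · simp [h]
    · have h1 := le_add_rpow_mul_rpow (norm_nonneg (G t)) hc hq (hqp t h)
      have h2 : 0 ≤ c ^ (1 - q) := by positivity
      have h3 := mul_le_mul_of_nonneg_left h1 (hk0 t)
      have h4 := mul_nonneg (hk0 t) h2
      linarith
  refine (norm_integral_le_integral_norm _).trans ?_
  refine (integral_mono hG.norm ((hk.mul_const c).add (hg.const_mul _)) hbd).trans_eq ?_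
  rw [integral_add' (hk.mul_const c) (hg.const_mul _), integral_mul_const, integral_const_mul, hk1,
    one_mul]

/-- The pointwise modular estimate for mollification under log-Hölder continuity. -/
lemma norm_rpow_convolution_le {p : Rn n → ℝ} (hp : IsExponent p) {F : Type*}
    [NormedAddCommGroup F] [NormedSpace ℝ F] {G : Rn n → F}
    (hG : LocallyIntegrable G volume)
    (hg : LocallyIntegrable (fun y => 1 + ‖G y‖ ^ p y) volume) (R : ℝ) :
    ∃ C : ℝ, 0 ≤ C ∧ ∀ ρ : ContDiffBump (0 : Rn n), ρ.rOut = 2 * ρ.rIn → ρ.rOut ≤ 1 →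
      ∀ x ∈ ball (0 : Rn n) R,
        ‖(ρ.normed volume ⋆[lsmul ℝ ℝ, volume] G : Rn n → F) x‖ ^ p x ≤
        C * (ρ.normed volume ⋆[lsmul ℝ ℝ, volume] (fun y => 1 + ‖G y‖ ^ p y) : Rn n → ℝ) x := by
  obtain ⟨P, hP1, hP⟩ := hp.exists_forall_le
  obtain ⟨L, hL, hlog⟩ := hp.logHolder
  have hg0 : ∀ y, 0 ≤ 1 + ‖G y‖ ^ p y := fun y => by positivity
  obtain ⟨J, hJ1, hJ⟩ := convolution_normed_le hg hg0 R
  refine ⟨2 ^ P * (J ^ (P * L) * Real.exp (2 * n * (P * L))), by positivity,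
    fun ρ hρ hρ1 x hx => ?_⟩
  have hI := hJ ρ hρ1 x hx
  rw [convolution_lsmul_swap] at hI ⊢
  rw [convolution_lsmul_swap]
  have intg := integrable_normed_smul ρ hg x
  have int1 : Integrable (fun t => ρ.normed volume (x - t)) volume := by
    simpa using integrable_normed_smul ρ (locallyIntegrable_const (1 : ℝ)) x
  set I := ∫ t, ρ.normed volume (x - t) • (1 + ‖G t‖ ^ p t) with hIdef
  have hρ0 : ∀ y, 0 ≤ ρ.normed volume y := ρ.nonneg_normed
  -- The summand 1 in the modular density gives I ≥ 1, so powers of I increase with the exponent.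
  have hI1 : 1 ≤ I := by
    rw [← integral_normed_sub ρ x]
    refine integral_mono int1 intg fun t => ?_
    have : 0 ≤ ‖G t‖ ^ p t := by positivity
    exact le_mul_of_one_le_right (hρ0 _) (by linarith)
  set T := Real.exp 1 + 1 / (2 * ρ.rIn)
  have hr := ρ.rIn_pos
  have hT1 : Real.exp 1 ≤ T := by
    have : 0 < 1 / (2 * ρ.rIn) := by positivity
    linarith
  have hlT : 0 < Real.log T := Real.log_pos (by linarith [Real.add_one_le_exp (1 : ℝ)])
  set w := L / Real.log T
  have hw : 0 < w := by positivity
  have hpx := hp.one_le x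
  -- A lower bound for `p` on the support of the kernel: there |x - t| < 2 `rIn`, so 1/p(t) ≤ 1/p(x)
  -- + w, and also 1/p(t) ≤ 1.
  set q := (min 1 (1 / p x + w))⁻¹ with hq
  have hm0 : 0 < min 1 (1 / p x + w) := lt_min one_pos (by positivity)
  have hq1 : 1 ≤ q := (one_le_inv₀ hm0).2 (min_le_left _ _)
  have hq2 : 1 / q ≤ 1 / p x + w := by
    rw [hq, one_div, inv_inv]
    exact min_le_right _ _
  have hqp : ∀ t, ρ.normed volume (x - t) ≠ 0 → q ≤ p t := fun t ht => by
    have h1 := dist_lt_of_normed_sub_ne_zero ht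
    have hpt := hp.one_le t
    have h2 : 1 / p t ≤ 1 / p x + w := by
      rcases eq_or_ne x t with rfl | hne
      · linarith
      · have h0 : 0 < ‖x - t‖ := norm_pos_iff.2 (sub_ne_zero.2 hne)
        have h3 : L / Real.log (Real.exp 1 + 1 / ‖x - t‖) ≤ w := by
          have : T ≤ Real.exp 1 + 1 / ‖x - t‖ := by
            have : 1 / (2 * ρ.rIn) ≤ 1 / ‖x - t‖ := by
              rw [hρ] at h1
              gcongr
            linarith
          exact div_le_div_of_nonneg_left hL.le hlT
            (Real.log_le_log (by linarith [Real.exp_pos (1 : ℝ)]) this)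
        have h4 := (abs_le.1 (hlog x t)).1
        linarith
    rw [hq]
    refine inv_le_of_inv_le₀ (by linarith) (le_min ?_ ?_)
    · exact inv_le_one_of_one_le₀ hpt
    · rwa [one_div] at h2
  have hc1 : 1 ≤ I ^ (1 / q) := Real.one_le_rpow hI1 (by positivity)
  have hρ0' : ∀ t, 0 ≤ ρ.normed volume (x - t) := fun t => hρ0 _
  have hN : ‖∫ t, ρ.normed volume (x - t) • G t‖ ≤ I ^ (1 / q) + (I ^ (1 / q)) ^ (1 - q) * I := by
    have := norm_integral_smul_le_add hρ0' int1 (integral_normed_sub ρ x)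
      (integrable_normed_smul ρ hG x) intg hc1 hq1 hqp
    exact this
  have h5 := rpow_le_of_le_add (norm_nonneg _) hI1 (by linarith) hpx (hP x) hw.le hq2 hN
  refine h5.trans ?_
  have h6 := rpow_log_le (by linarith : (0:ℝ) ≤ I) hJ1 hr (by linarith : (0:ℝ) ≤ P) hL.le hI
  gcongr

/-! ### Fatou's lemma, Carathéodory measurability and variable exponent integrability -/

/-- A form of Fatou's lemma for Bochner integrals. -/
lemma integral_le_of_tendsto {α : Type*} [MeasurableSpace α] {μ : Measure α} {F : ℕ → α → ℝ}
    {F' : α → ℝ} {d : ℕ → ℝ} {D : ℝ} (h0 : ∀ k x, 0 ≤ F k x) (hF : ∀ k, Integrable (F k) μ)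
    (hF' : Integrable F' μ) (hlim : ∀ᵐ x ∂μ, Tendsto (fun k => F k x) atTop (𝓝 (F' x)))
    (hd : ∀ k, ∫ x, F k x ∂μ ≤ d k) (hD : Tendsto d atTop (𝓝 D)) : ∫ x, F' x ∂μ ≤ D := by
  have h0' : ∀ᵐ x ∂μ, 0 ≤ F' x := by
    filter_upwards [hlim] with x hx using ge_of_tendsto' hx fun k => h0 k x
  have hD0 : 0 ≤ D := ge_of_tendsto' hD fun k => (integral_nonneg (h0 k)).trans (hd k)
  rw [← ENNReal.ofReal_le_ofReal_iff hD0, ofReal_integral_eq_lintegral_ofReal hF' h0']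
  have e : ∀ᵐ x ∂μ, ENNReal.ofReal (F' x) = liminf (fun k => ENNReal.ofReal (F k x)) atTop := by
    filter_upwards [hlim] with x hx using ((ENNReal.tendsto_ofReal hx).liminf_eq).symm
  rw [lintegral_congr_ae e]
  refine (lintegral_liminf_le' fun k => (hF k).aemeasurable.ennreal_ofReal).trans ?_
  rw [← (ENNReal.tendsto_ofReal hD).liminf_eq]
  refine liminf_le_liminf (.of_forall fun k => ?_)
  rw [← ofReal_integral_eq_lintegral_ofReal (hF k) (.of_forall (h0 k))]
  exact ENNReal.ofReal_le_ofReal (hd k)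

/-- Compositions of Carathéodory functions with measurable functions are measurable. -/
lemma aemeasurable_caratheodory {α E F : Type*} [MeasurableSpace α] {μ : Measure α}
    [PseudoMetricSpace E] [SecondCountableTopology E] [MeasurableSpace E] [BorelSpace E]
    [NormedAddCommGroup F] [SecondCountableTopology F] [MeasurableSpace F] [BorelSpace F]
    {B : α → E → F} (hB : ∀ y, AEMeasurable (fun x => B x y) μ) (hBc : ∀ x, Continuous (B x))
    {w : α → E} (hw : AEMeasurable w μ) : AEMeasurable (fun x => B x (w x)) μ := by
  have hsm := hw.measurable_mk.stronglyMeasurable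
  refine AEMeasurable.congr (f := fun x => B x (hw.mk w x)) ?_
    (hw.ae_eq_mk.mono fun x hx => by simp only [← hx])
  -- Continuity in the second variable reduces the claim to simple functions, for which the
  -- composition is a finite sum over fibres.
  refine aemeasurable_of_tendsto_metrizable_ae' (f := fun k x => B x (hsm.approx k x))
    (fun k => ?_)
    (.of_forall fun x => ((hBc x).tendsto _).comp (hsm.tendsto_approx x))
  set s := hsm.approx k
  have e : (fun x => B x (s x)) =
      ∑ y ∈ s.range, (s ⁻¹' {y}).indicator (fun x => B x y) := by
    ext x
    rw [Finset.sum_apply, Finset.sum_eq_single (s x)]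
    · simp
    · intro y _ hy
      exact Set.indicator_of_notMem (fun h => hy h.symm) _
    · intro h
      exact absurd (s.mem_range_self x) h
  rw [e]
  exact Finset.aemeasurable_sum _ fun y _ => (hB y).indicator (s.measurableSet_fiber y)

/-- As `p` is bounded, undoing the scaling in the definition costs at most the constant factor (1 +
c)^P. -/
lemma MemLpVar.integrableOn {p : Rn n → ℝ} (hp : IsExponent p) {K : Set (Rn n)} {F : Type*}
    [NormedAddCommGroup F] [NormedSpace ℝ F] {v : Rn n → F} (hv : MemLpVar p K v) :
    IntegrableOn (fun x => ‖v x‖ ^ p x) K volume := by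
  obtain ⟨P, hP1, hP⟩ := hp.exists_forall_le
  obtain ⟨hm, c, hc, hfin⟩ := hv
  have hmeas : ∀ w : Rn n → F, AEStronglyMeasurable w (volume.restrict K) →
      AEStronglyMeasurable (fun x => ‖w x‖ ^ p x) (volume.restrict K) := fun w hw =>
    (hw.norm.aemeasurable.pow hp.continuous.measurable.aemeasurable).aestronglyMeasurable
  have h1 : IntegrableOn (fun x => ‖c⁻¹ • v x‖ ^ p x) K volume := by
    refine ⟨hmeas _ (hm.const_smul _), ?_⟩
    rw [hasFiniteIntegral_iff_ofReal (.of_forall fun x => by positivity)]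
    exact hfin
  refine (h1.const_mul ((1 + c) ^ P)).mono' (hmeas v hm) (.of_forall fun x => ?_)
  rw [Real.norm_of_nonneg (by positivity)]
  have e : v x = c • (c⁻¹ • v x) := by rw [smul_inv_smul₀ hc.ne']
  have hpx := hp.one_le x
  calc ‖v x‖ ^ p x = c ^ p x * ‖c⁻¹ • v x‖ ^ p x := by
        nth_rewrite 1 [e]
        rw [norm_smul, Real.norm_of_nonneg hc.le, Real.mul_rpow hc.le (norm_nonneg _)]
    _ ≤ (1 + c) ^ P * ‖c⁻¹ • v x‖ ^ p x := by
        gcongr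
        calc c ^ p x ≤ (1 + c) ^ p x := by gcongr; linarith
          _ ≤ (1 + c) ^ P := Real.rpow_le_rpow_of_exponent_le (by linarith) (hP x)

lemma MemW1Loc.locallyIntegrable {p u : Rn n → ℝ} {G : Rn n → Rn n} (hp : IsExponent p)
    (h : MemW1Loc p u G) : LocallyIntegrable (fun x => ‖G x‖ ^ p x) volume :=
  locallyIntegrable_iff.2 fun K hK => ((h.2 K hK).2).integrableOn hp

lemma rpow_sub_one_mul_self {t r : ℝ} (ht : 0 ≤ t) (hr : 1 ≤ r) : t ^ (r - 1) * t = t ^ r := by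
  rcases ht.eq_or_lt with rfl | ht
  · rw [mul_zero, Real.zero_rpow (by linarith)]
  · rw [← Real.rpow_add_one ht.ne']
    simp

/-- The larger of s and t controls the product, so no constant depends on the exponent. -/
lemma rpow_sub_one_mul_le {s t r : ℝ} (hs : 0 ≤ s) (ht : 0 ≤ t) (hr : 1 ≤ r) :
    s ^ (r - 1) * t ≤ s ^ r + t ^ r := by
  have h1 : 0 ≤ s ^ r := by positivity
  have h2 : 0 ≤ t ^ r := by positivity
  rcases le_total s t with h | h
  · calc s ^ (r - 1) * t ≤ t ^ (r - 1) * t := by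
          gcongr
      _ ≤ s ^ r + t ^ r := by rw [rpow_sub_one_mul_self ht hr]; linarith
  · calc s ^ (r - 1) * t ≤ s ^ (r - 1) * s := by gcongr
      _ ≤ s ^ r + t ^ r := by rw [rpow_sub_one_mul_self hs hr]; linarith

/-! ### Mollified gradients and passage to the limit -/

/-- A standard sequence of mollifying bump functions. -/
noncomputable def mollifier (n : ℕ) (k : ℕ) : ContDiffBump (0 : Rn n) where
  rIn := 1 / (k + 1) / 2
  rOut := 1 / (k + 1)
  rIn_pos := by positivity
  rIn_lt_rOut := half_lt_self (by positivity)

lemma mollifier_rOut (k : ℕ) : (mollifier n k).rOut = 2 * (mollifier n k).rIn := by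
  simp only [mollifier]
  ring

lemma mollifier_rOut_le (k : ℕ) : (mollifier n k).rOut ≤ 1 := by
  simp only [mollifier]
  rw [div_le_one (by positivity)]
  have : (0 : ℝ) ≤ k := by positivity
  linarith

lemma tendsto_mollifier : Tendsto (fun k => (mollifier n k).rOut) atTop (𝓝 0) :=
  tendsto_one_div_add_atTop_nhds_zero_nat

/-- Mollification by the `k`-th standard mollifier. -/
noncomputable abbrev mollify {F : Type*} [NormedAddCommGroup F] [NormedSpace ℝ F] (k : ℕ)
    (g : Rn n → F) : Rn n → F :=
  (mollifier n k).normed volume ⋆[lsmul ℝ ℝ, volume] g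

lemma continuous_mollify {F : Type*} [NormedAddCommGroup F] [NormedSpace ℝ F] [CompleteSpace F]
    (k : ℕ) {g : Rn n → F} (hg : LocallyIntegrable g volume) : Continuous (mollify k g) :=
  (mollifier n k).hasCompactSupport_normed.continuous_convolution_left _
    (mollifier n k).continuous_normed hg

lemma ae_tendsto_mollify {F : Type*} [NormedAddCommGroup F] [NormedSpace ℝ F] [CompleteSpace F]
    {g : Rn n → F} (hg : LocallyIntegrable g volume) :
    ∀ᵐ x ∂volume, Tendsto (fun k => mollify k g x) atTop (𝓝 (g x)) :=
  ContDiffBump.ae_convolution_tendsto_right_of_locallyIntegrable (K := 2) tendsto_mollifier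
    (.of_forall fun k => (mollifier_rOut k).le) hg

lemma integrable_mul_inner {h v : Rn n → Rn n} (hh : LocallyIntegrable h volume)
    (hv : Continuous v) {ζ : Rn n → ℝ} (hζ : Continuous ζ) (hζc : HasCompactSupport ζ) :
    Integrable (fun x => ζ x * inner ℝ (h x) (v x)) volume := by
  have h1 : Integrable (fun x => (ζ x * ‖v x‖) • h x) volume :=
    hh.integrable_smul_left_of_hasCompactSupport (hζ.mul hv.norm) hζc.mul_right
  refine h1.mono (hζ.aestronglyMeasurable.mul
    (hh.aestronglyMeasurable.inner hv.aestronglyMeasurable)) (.of_forall fun x => ?_)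
  rw [norm_mul, norm_smul, norm_mul, norm_norm, mul_assoc]
  refine mul_le_mul_of_nonneg_left ?_ (norm_nonneg _)
  rw [mul_comm]
  exact norm_inner_le_norm _ _

lemma locallyIntegrable_of_growth {p : Rn n → ℝ} {h G : Rn n → Rn n} {b : ℝ} (hp : IsExponent p)
    (hm : AEStronglyMeasurable h volume) (hb : 0 ≤ b)
    (hh : ∀ x, ‖h x‖ ≤ b * ‖G x‖ ^ (p x - 1))
    (hg : LocallyIntegrable (fun y => 1 + ‖G y‖ ^ p y) volume) : LocallyIntegrable h volume := by
  refine (hg.smul b).mono hm (.of_forall fun x => (hh x).trans ?_)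
  have h0 : 0 ≤ ‖G x‖ ^ p x := by positivity
  rw [Pi.smul_apply, smul_eq_mul, Real.norm_of_nonneg (by positivity)]
  have := rpow_sub_one_mul_le (norm_nonneg (G x)) zero_le_one (hp.one_le x)
  rw [Real.one_rpow] at this
  gcongr
  linarith

/-- On the support of ζ, |⟨h, Gₖ⟩| ≤ b(|G|^p + Cgₖ), where Gₖ and gₖ are the mollifications of G and
g = 1 + |G|^p. The integrals of the majorant against ζ converge, so Fatou's lemma carries the upper
bound to the limit. -/
lemma integral_inner_le_of_mollify {p : Rn n → ℝ} (hp : IsExponent p) {h G : Rn n → Rn n} {b : ℝ}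
    (hm : AEStronglyMeasurable h volume) (hb : 0 ≤ b)
    (hh : ∀ x, ‖h x‖ ≤ b * ‖G x‖ ^ (p x - 1)) (hG : LocallyIntegrable G volume)
    (hg' : LocallyIntegrable (fun y => ‖G y‖ ^ p y) volume) {ζ : Rn n → ℝ} (hζ : Continuous ζ)
    (hζc : HasCompactSupport ζ) (hζ0 : ∀ x, 0 ≤ ζ x) {D : ℝ}
    (hD : ∀ k, ∫ x, ζ x * inner ℝ (h x) (mollify k G x) ≤ D) :
    Integrable (fun x => ζ x * inner ℝ (h x) (G x)) volume ∧
      ∫ x, ζ x * inner ℝ (h x) (G x) ≤ D := by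
  set g : Rn n → ℝ := fun y => 1 + ‖G y‖ ^ p y
  have hg : LocallyIntegrable g volume := (locallyIntegrable_const (1 : ℝ)).add hg'
  have hhl := locallyIntegrable_of_growth hp hm hb hh hg
  obtain ⟨R, hR⟩ := hζc.isCompact.isBounded.subset_ball (0 : Rn n)
  obtain ⟨C, hC0, hC⟩ := norm_rpow_convolution_le hp hG hg R
  have i1 : Integrable (fun x => ζ x * (b * ‖G x‖ ^ p x)) volume := by
    simpa [smul_eq_mul] using
      (hg'.smul b).integrable_smul_left_of_hasCompactSupport hζ hζc
  have i2 : Integrable (fun x => ζ x * inner ℝ (h x) (G x)) volume := by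
    refine i1.mono' (hζ.aestronglyMeasurable.mul (hm.inner hG.aestronglyMeasurable))
      (.of_forall fun x => ?_)
    rw [norm_mul, Real.norm_of_nonneg (hζ0 x)]
    refine mul_le_mul_of_nonneg_left ((norm_inner_le_norm _ _).trans ?_) (hζ0 x)
    refine (mul_le_mul_of_nonneg_right (hh x) (norm_nonneg _)).trans_eq ?_
    rw [mul_assoc, rpow_sub_one_mul_self (norm_nonneg _) (hp.one_le x)]
  refine ⟨i2, ?_⟩
  have i3 : ∀ k, Integrable (fun x => ζ x * inner ℝ (h x) (mollify k G x)) volume := fun k =>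
    integrable_mul_inner hhl (continuous_mollify k hG) hζ hζc
  have i4 : ∀ k, Integrable (fun x => b * C * (ζ x * mollify k g x)) volume := fun k =>
    ((hζ.mul (continuous_mollify k hg)).integrable_of_hasCompactSupport hζc.mul_right).const_mul _
  have i5 : Integrable (fun x => b * C * (ζ x * g x)) volume :=
    (hg.integrable_smul_left_of_hasCompactSupport hζ hζc).const_mul _
  set Q := ∫ x, ζ x * (b * ‖G x‖ ^ p x)
  have hlim : Tendsto (fun k => D + Q + b * C * ∫ x, ζ x * mollify k g x)
      atTop (𝓝 (D + Q + b * C * ∫ x, ζ x * g x)) :=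
    ((tendsto_integral_mul_convolution tendsto_mollifier hg hζ hζc).const_mul _).const_add _
  -- The majorant is added to make the integrands nonnegative; its contribution cancels in the
  -- limit.
  have hfatou := integral_le_of_tendsto
    (F := fun k x => ζ x * inner ℝ (h x) (mollify k G x) + ζ x * (b * ‖G x‖ ^ p x) +
      b * C * (ζ x * mollify k g x))
    (F' := fun x => ζ x * inner ℝ (h x) (G x) + ζ x * (b * ‖G x‖ ^ p x) + b * C * (ζ x * g x))
    (μ := volume) ?_ (fun k => ((i3 k).add i1).add (i4 k)) ((i2.add i1).add i5) ?_ ?_ hlim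
  · rw [integral_add (by exact i2.add i1) i5, integral_add i2 i1, integral_const_mul] at hfatou
    linarith
  · intro k x
    by_cases hx : ζ x = 0
    · simp [hx]
    · have hxR : x ∈ ball (0 : Rn n) R := hR (subset_tsupport _ hx)
      have h1 := hC _ (mollifier_rOut k) (mollifier_rOut_le k) x hxR
      have h2 := rpow_sub_one_mul_le (norm_nonneg (G x)) (norm_nonneg (mollify k G x))
        (hp.one_le x)
      have h3 : |inner ℝ (h x) (mollify k G x)| ≤ b * (‖G x‖ ^ (p x - 1) * ‖mollify k G x‖) := by
        rw [← mul_assoc]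
        exact (abs_real_inner_le_norm _ _).trans
          (mul_le_mul_of_nonneg_right (hh x) (norm_nonneg _))
      have h4 : b * (‖G x‖ ^ (p x - 1) * ‖mollify k G x‖) ≤
          b * (‖G x‖ ^ p x + C * mollify k g x) := by
        gcongr
        exact h2.trans (by gcongr)
      have h5 := neg_abs_le (inner ℝ (h x) (mollify k G x))
      have h6 : 0 ≤ inner ℝ (h x) (mollify k G x) + b * (‖G x‖ ^ p x + C * mollify k g x) := by
        linarith
      have h7 := mul_nonneg (hζ0 x) h6
      linarith
  · filter_upwards [ae_tendsto_mollify hG, ae_tendsto_mollify hg] with x hx1 hx2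
    exact (((tendsto_const_nhds.inner hx1).const_mul _).add_const _).add
      ((hx2.const_mul _).const_mul _)
  · intro k
    rw [integral_add (by exact (i3 k).add i1) (i4 k), integral_add (i3 k) i1, integral_const_mul]
    have := hD k
    linarith

/-! ### The inequality tested with the mollified solution -/

lemma abs_mollify_le {u : Rn n → ℝ} (hu : LocallyIntegrable u volume) {M : ℝ}
    (hM : ∀ᵐ x ∂volume, |u x| ≤ M) (k : ℕ) (x : Rn n) : |mollify k u x| ≤ M := by
  rw [← Real.norm_eq_abs, mollify, convolution_lsmul_swap]
  have hint : Integrable (fun t => (mollifier n k).normed volume (x - t)) volume := by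
    simpa using integrable_normed_smul (mollifier n k) (locallyIntegrable_const (1 : ℝ)) x
  refine (norm_integral_le_integral_norm _).trans ?_
  calc ∫ t, ‖(mollifier n k).normed volume (x - t) • u t‖
      ≤ ∫ t, (mollifier n k).normed volume (x - t) * M := by
        refine integral_mono_ae (integrable_normed_smul _ hu x).norm (hint.mul_const M) ?_
        filter_upwards [hM] with t ht
        rw [norm_smul, Real.norm_of_nonneg ((mollifier n k).nonneg_normed _)]
        exact mul_le_mul_of_nonneg_left ht ((mollifier n k).nonneg_normed _)
    _ = M := by rw [integral_mul_const, integral_normed_sub, one_mul]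

lemma contDiff_mollify {u : Rn n → ℝ} (hu : LocallyIntegrable u volume) (k : ℕ) :
    ContDiff ℝ ∞ (mollify k u) :=
  (mollifier n k).hasCompactSupport_normed.contDiff_convolution_left _
    (mollifier n k).contDiff_normed hu

/-- The supersolution inequality tested with `(uₖ + 2M) ζ`, where `uₖ` is a mollification of `u`. -/
lemma integral_mul_inner_mollify_le {u : Rn n → ℝ} {G h : Rn n → Rn n}
    (hw : HasWeakGradient u G) (hh : LocallyIntegrable h volume) {f : ℝ → ℝ} {c M : ℝ}
    (hc : 0 ≤ c) (hM0 : 0 ≤ M) (hM : ∀ᵐ x ∂volume, |u x| ≤ M)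
    (hcf : ∀ᵐ x ∂volume, c ≤ f (u x))
    (hsup : ∀ φ : Rn n → ℝ, IsTest φ → (∀ x, 0 ≤ φ x) →
      Integrable (fun x => f (u x) * φ x) volume ∧
      ∫ x, f (u x) * φ x ≤ -∫ x, inner ℝ (h x) (gradient φ x))
    {ζ : Rn n → ℝ} (hζ : IsTest ζ) (hζ0 : ∀ x, 0 ≤ ζ x) (k : ℕ) :
    ∫ x, ζ x * inner ℝ (h x) (mollify k G x) ≤
      ∫ x, (3 * M * (‖fderiv ℝ ζ x‖ * ‖h x‖) - c * M * ζ x) := by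
  have hul := hw.1
  -- The shift 2M gives M ≤ v ≤ 3M uniformly in k: the lower bound serves the f(u) term, the upper
  -- one the cutoff term.
  set v : Rn n → ℝ := fun x => mollify k u x + 2 * M
  have hvC : ContDiff ℝ ∞ v := (contDiff_mollify hul k).add contDiff_const
  have hub := abs_mollify_le hul hM k
  have hvM : ∀ x, M ≤ v x := fun x => by linarith [(abs_le.1 (hub x)).1]
  have hv3 : ∀ x, |v x| ≤ 3 * M := fun x => by
    have := abs_le.1 (hub x)
    rw [abs_le]
    constructor <;> linarith [hvM x]
  have hφ : IsTest (fun x => v x * ζ x) := ⟨hvC.mul hζ.1, hζ.2.mul_left⟩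
  have hφ0 : ∀ x, 0 ≤ v x * ζ x := fun x => mul_nonneg (hM0.trans (hvM x)) (hζ0 x)
  obtain ⟨hi, hle⟩ := hsup _ hφ hφ0
  have hgrad : ∀ x, inner ℝ (h x) (gradient (fun x => v x * ζ x) x) =
      v x * inner ℝ (h x) (gradient ζ x) + ζ x * inner ℝ (h x) (mollify k G x) := fun x => by
    have h1 : HasFDerivAt v (innerSL ℝ (mollify k G x)) x :=
      (hw.hasFDerivAt_convolution (isTest_normed (mollifier n k)) x).add_const _
    have h2 := (hζ.1.differentiable (by simp) x).hasFDerivAt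
    have h3 := h1.fun_mul h2
    rw [real_inner_comm, inner_gradient_left, h3.fderiv, real_inner_comm _ (h x),
      inner_gradient_left, real_inner_comm _ (h x)]
    simp [innerSL_apply_apply]
  have i1 : Integrable (fun x => v x * inner ℝ (h x) (gradient ζ x)) volume := by
    have : Integrable (fun x => ‖gradient ζ x‖ • h x) volume :=
      hh.integrable_smul_left_of_hasCompactSupport hζ.continuous_gradient.norm
        hζ.hasCompactSupport_gradient.norm
    refine (this.norm.const_mul (3 * M)).mono' (hvC.continuous.aestronglyMeasurable.mul
      (hh.aestronglyMeasurable.inner hζ.continuous_gradient.aestronglyMeasurable))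
      (.of_forall fun x => ?_)
    rw [norm_mul, norm_smul, norm_norm, Real.norm_eq_abs, mul_comm ‖gradient ζ x‖]
    exact mul_le_mul (hv3 x) (norm_inner_le_norm _ _) (norm_nonneg _) (by positivity)
  have i2 : Integrable (fun x => ζ x * inner ℝ (h x) (mollify k G x)) volume :=
    integrable_mul_inner hh (continuous_mollify k hw.2.1) hζ.1.continuous hζ.2
  have i3 : Integrable (fun x => 3 * M * (‖fderiv ℝ ζ x‖ * ‖h x‖)) volume := by
    have : Integrable (fun x => ‖fderiv ℝ ζ x‖ • h x) volume :=
      hh.integrable_smul_left_of_hasCompactSupport (hζ.1.continuous_fderiv (by simp)).norm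
        (hζ.2.fderiv ℝ).norm
    simpa [norm_smul] using this.norm.const_mul (3 * M)
  have i4 : Integrable (fun x => c * M * ζ x) volume :=
    (hζ.1.continuous.integrable_of_hasCompactSupport hζ.2).const_mul _
  simp only [hgrad] at hle
  rw [integral_add i1 i2] at hle
  have h5 : ∫ x, c * M * ζ x ≤ ∫ x, f (u x) * (v x * ζ x) := by
    refine integral_mono_ae i4 hi ?_
    filter_upwards [hcf] with x hx
    rw [mul_assoc]
    have := mul_le_mul_of_nonneg_right (hvM x) (hζ0 x)
    exact mul_le_mul hx this (mul_nonneg hM0 (hζ0 x)) (hc.trans hx)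
  have h6 : -∫ x, v x * inner ℝ (h x) (gradient ζ x) ≤
      ∫ x, 3 * M * (‖fderiv ℝ ζ x‖ * ‖h x‖) := by
    rw [← integral_neg]
    refine integral_mono i1.neg i3 fun x => ?_
    rw [real_inner_comm, inner_gradient_left]
    refine (neg_le_abs _).trans ?_
    rw [abs_mul]
    exact mul_le_mul (hv3 x) ((fderiv ℝ ζ x).le_opNorm (h x)) (abs_nonneg _) (by positivity)
  rw [integral_sub i3 i4]
  linarith

/-! ### Cutoff functions and the Caccioppoli estimate -/

/-- A version of Young's inequality adapted to cutoff functions. -/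
lemma mul_rpow_mul_pow_le {t s η a K r : ℝ} {m : ℕ} (ht : 0 ≤ t) (hs : 0 ≤ s) (hη : 0 ≤ η)
    (hη1 : η ≤ 1) (ha : 0 < a) (hK : 0 ≤ K) (hr : 1 ≤ r) (hm : r ≤ m + 1) (hKs : K * s ≤ a) :
    K * t ^ (r - 1) * (η ^ m * s) ≤ a * t ^ r * η ^ (m + 1) + K * s := by
  have hKs0 : 0 ≤ K * s := by positivity
  -- Either the gradient term absorbs the left side outright, or tη ≤ 1 and then t^(r-1) η^m ≤
  -- (tη)^(r-1) ≤ 1. The error stays linear in s, whatever r is.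
  rcases le_or_gt (K * s) (a * t * η) with h | h
  · calc K * t ^ (r - 1) * (η ^ m * s) = (K * s) * (t ^ (r - 1) * η ^ m) := by ring
      _ ≤ (a * t * η) * (t ^ (r - 1) * η ^ m) := by gcongr
      _ = a * (t ^ (r - 1) * t) * η ^ (m + 1) := by ring
      _ ≤ a * t ^ r * η ^ (m + 1) + K * s := by
        rw [rpow_sub_one_mul_self ht hr]
        linarith
  · have h1 : t * η ≤ 1 := by
      have : a * (t * η) ≤ a * 1 := by linarith
      exact le_of_mul_le_mul_left this ha
    have h2 : η ^ m ≤ η ^ (r - 1) := by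
      rcases hη.eq_or_lt with rfl | hη
      · rcases Nat.eq_zero_or_pos m with rfl | hm0
        · have : r = 1 := by
            push_cast at hm
            linarith
          simp [this]
        · rw [zero_pow hm0.ne']
          positivity
      · rw [← Real.rpow_natCast]
        exact Real.rpow_le_rpow_of_exponent_ge hη hη1 (by linarith)
    have h3 : t ^ (r - 1) * η ^ m ≤ 1 := by
      calc t ^ (r - 1) * η ^ m ≤ t ^ (r - 1) * η ^ (r - 1) := by gcongr
        _ = (t * η) ^ (r - 1) := (Real.mul_rpow ht hη).symm
        _ ≤ 1 := Real.rpow_le_one (by positivity) h1 (by linarith)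
    calc K * t ^ (r - 1) * (η ^ m * s) = (K * s) * (t ^ (r - 1) * η ^ m) := by ring
      _ ≤ (K * s) * 1 := by gcongr
      _ ≤ a * t ^ r * η ^ (m + 1) + K * s := by
        have : 0 ≤ a * t ^ r * η ^ (m + 1) := by positivity
        linarith

/-- All cutoffs are dilations of one fixed bump, so `C` does not depend on `R`. -/
lemma exists_cutoff (n : ℕ) : ∃ C : ℝ, 0 ≤ C ∧ ∀ R : ℝ, 0 < R → ∃ η : Rn n → ℝ, IsTest η ∧
    (∀ x, 0 ≤ η x) ∧ (∀ x, η x ≤ 1) ∧ (∀ x ∈ closedBall (0 : Rn n) R, η x = 1) ∧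
    (∀ x, ‖fderiv ℝ η x‖ ≤ C / R) ∧
    ∀ x ∉ closedBall (0 : Rn n) (2 * R), fderiv ℝ η x = 0 := by
  let χ : ContDiffBump (0 : Rn n) := ⟨1, 2, one_pos, one_lt_two⟩
  have hχ : ContDiff ℝ ∞ χ := χ.contDiff
  obtain ⟨C, hC⟩ := (hχ.continuous_fderiv (by simp)).bounded_above_of_compact_support
    (χ.hasCompactSupport.fderiv ℝ)
  refine ⟨C, (norm_nonneg _).trans (hC 0), fun R hR => ?_⟩
  have hder : ∀ x, HasFDerivAt (fun x => χ (R⁻¹ • x)) (R⁻¹ • fderiv ℝ χ (R⁻¹ • x)) x := fun x => by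
    have h1 : HasFDerivAt (fun x : Rn n => R⁻¹ • x) (R⁻¹ • ContinuousLinearMap.id ℝ (Rn n)) x :=
      (hasFDerivAt_id x).const_smul R⁻¹
    have h2 := (hχ.differentiable (by simp) (R⁻¹ • x)).hasFDerivAt.comp x h1
    refine h2.congr_fderiv ?_
    ext v
    simp
  refine ⟨fun x => χ (R⁻¹ • x), ⟨hχ.comp (contDiff_const_smul _),
    χ.hasCompactSupport.comp_homeomorph (Homeomorph.smulOfNeZero R⁻¹ (inv_ne_zero hR.ne'))⟩,
    fun x => χ.nonneg, fun x => χ.le_one, fun x hx => χ.one_of_mem_closedBall ?_, fun x => ?_,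
    fun x hx => ?_⟩
  · rw [mem_closedBall_zero_iff] at hx ⊢
    rw [norm_smul, norm_inv, Real.norm_of_nonneg hR.le, inv_mul_le_iff₀ hR]
    simpa [χ] using hx
  · rw [(hder x).fderiv, norm_smul, norm_inv, Real.norm_of_nonneg hR.le, div_eq_inv_mul]
    gcongr
    exact hC _
  · rw [(hder x).fderiv]
    have : R⁻¹ • x ∉ tsupport χ := by
      rw [χ.tsupport_eq, mem_closedBall_zero_iff, norm_smul, norm_inv, Real.norm_of_nonneg hR.le,
        inv_mul_le_iff₀ hR]
      rw [mem_closedBall_zero_iff] at hx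
      simpa [χ, mul_comm] using hx
    rw [notMem_tsupport_iff_eventuallyEq.1 this |>.fderiv_eq]
    simp

/-- The Caccioppoli-type estimate on balls for bounded weak solutions of `div h ≥ f(u)`, where `h`
is a field of `p(·)`-growth in the gradient of `u` and `f(u) ≥ c`. -/
lemma exists_mul_measure_le {p : Rn n → ℝ} (hp : IsExponent p) {u : Rn n → ℝ} {G h : Rn n → Rn n}
    (hu : MemW1Loc p u G) (hm : AEStronglyMeasurable h volume) {a b : ℝ} (ha : 0 < a) (hb : 0 ≤ b)
    (hha : ∀ x, a * ‖G x‖ ^ p x ≤ inner ℝ (h x) (G x))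
    (hhb : ∀ x, ‖h x‖ ≤ b * ‖G x‖ ^ (p x - 1)) {f : ℝ → ℝ} {c M : ℝ}
    (hc : 0 ≤ c) (hM0 : 0 ≤ M) (hM : ∀ᵐ x ∂volume, |u x| ≤ M)
    (hcf : ∀ᵐ x ∂volume, c ≤ f (u x))
    (hsup : ∀ φ : Rn n → ℝ, IsTest φ → (∀ x, 0 ≤ φ x) →
      Integrable (fun x => f (u x) * φ x) volume ∧
      ∫ x, f (u x) * φ x ≤ -∫ x, inner ℝ (h x) (gradient φ x)) :
    ∃ K : ℝ, 0 ≤ K ∧ ∀ R : ℝ, 0 < R → K / R ≤ a →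
      c * M * volume.real (closedBall (0 : Rn n) R) ≤
        K / R * volume.real (closedBall (0 : Rn n) (2 * R)) := by
  obtain ⟨P, hP1, hP⟩ := hp.exists_forall_le
  obtain ⟨C, hC0, hC⟩ := exists_cutoff n
  have hw := hu.1
  have hg' := hu.locallyIntegrable hp
  have hhl := locallyIntegrable_of_growth hp hm hb hhb
    ((locallyIntegrable_const (1 : ℝ)).add hg')
  -- The power m + 1 of the cutoff is at least p(x) everywhere, as the absorption argument requires.
  set m := ⌈P⌉₊
  have hPm : P ≤ m := Nat.le_ceil P
  set K := 3 * M * b * (m + 1) with hK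
  have hK0 : 0 ≤ K := by positivity
  refine ⟨K * C, by positivity, fun R hR hKR => ?_⟩
  obtain ⟨η, hη, hη0, hη1, hηR, hηC, hη2⟩ := hC R hR
  set ζ : Rn n → ℝ := fun x => η x ^ (m + 1) with hζdef
  have hζ0 : ∀ x, 0 ≤ ζ x := fun x => pow_nonneg (hη0 x) _
  have hζ : IsTest ζ :=
    ⟨hη.1.pow _, hη.2.comp_left (g := fun t : ℝ => t ^ (m + 1)) (zero_pow (Nat.succ_ne_zero m))⟩
  have hder : ∀ x, ‖fderiv ℝ ζ x‖ = (m + 1) * (η x ^ m * ‖fderiv ℝ η x‖) := fun x => by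
    rw [hζdef, fderiv_fun_pow _ (hη.1.differentiable (by simp) x), norm_smul]
    have : 0 ≤ η x ^ m := pow_nonneg (hη0 x) _
    simp only [nsmul_eq_mul, Nat.add_sub_cancel]
    rw [Real.norm_of_nonneg (by positivity)]
    push_cast
    ring
  obtain ⟨hint, hle⟩ := integral_inner_le_of_mollify hp hm hb hhb hw.2.1 hg' hζ.1.continuous hζ.2
    hζ0 (fun k => integral_mul_inner_mollify_le hw hhl hc hM0 hM hcf hsup hζ hζ0 k)
  have i3 : Integrable (fun x => 3 * M * (‖fderiv ℝ ζ x‖ * ‖h x‖)) volume := by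
    have : Integrable (fun x => ‖fderiv ℝ ζ x‖ • h x) volume :=
      hhl.integrable_smul_left_of_hasCompactSupport (hζ.1.continuous_fderiv (by simp)).norm
        (hζ.2.fderiv ℝ).norm
    simpa [norm_smul] using this.norm.const_mul (3 * M)
  have i4 : Integrable ζ volume := hζ.1.continuous.integrable_of_hasCompactSupport hζ.2
  have hfin : ∀ r : ℝ, volume (closedBall (0 : Rn n) r) ≠ ⊤ := fun r =>
    measure_closedBall_lt_top.ne
  rw [integral_sub i3 (i4.const_mul _), integral_const_mul, integral_const_mul] at hle
  have hlow : volume.real (closedBall (0 : Rn n) R) ≤ ∫ x, ζ x := by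
    rw [← integral_indicator_one measurableSet_closedBall]
    refine integral_mono ((integrable_indicator_iff measurableSet_closedBall).2
      (integrableOn_const (hfin R))) i4 fun x => ?_
    by_cases hx : x ∈ closedBall (0 : Rn n) R
    · rw [Set.indicator_of_mem hx]
      simp [hζdef, hηR x hx]
    · rw [Set.indicator_of_notMem hx]
      exact hζ0 x
  -- Pointwise absorption: coercivity bounds the gradient term by ζ⟨h, G⟩, and the error is at most
  -- KC/R and lives on B_2R. The condition KC/R ≤ a is what Young's inequality needs.
  have hpt : ∀ x, 3 * M * (‖fderiv ℝ ζ x‖ * ‖h x‖) ≤ ζ x * inner ℝ (h x) (G x) +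
      (closedBall (0 : Rn n) (2 * R)).indicator (fun _ => K * C / R) x := fun x => by
    set s := ‖fderiv ℝ η x‖ with hs
    have hs0 : 0 ≤ s := norm_nonneg _
    have hKs : K * s ≤ K * C / R := by
      rw [mul_div_assoc]
      exact mul_le_mul_of_nonneg_left (hηC x) hK0
    have hind : K * s ≤ (closedBall (0 : Rn n) (2 * R)).indicator (fun _ => K * C / R) x := by
      by_cases hx : x ∈ closedBall (0 : Rn n) (2 * R)
      · rwa [Set.indicator_of_mem hx]
      · rw [Set.indicator_of_notMem hx, hs, hη2 x hx]
        simp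
    have hy := mul_rpow_mul_pow_le (norm_nonneg (G x)) hs0 (hη0 x) (hη1 x) ha hK0 (hp.one_le x)
      (by linarith [hP x] : p x ≤ m + 1) (hKs.trans hKR)
    have h1 : 3 * M * (‖fderiv ℝ ζ x‖ * ‖h x‖) ≤
        3 * M * (‖fderiv ℝ ζ x‖ * (b * ‖G x‖ ^ (p x - 1))) := by
      gcongr
      exact hhb x
    have h2 : 3 * M * (‖fderiv ℝ ζ x‖ * (b * ‖G x‖ ^ (p x - 1))) =
        K * ‖G x‖ ^ (p x - 1) * (η x ^ m * s) := by
      rw [hder, hK]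
      ring
    have h3 := mul_le_mul_of_nonneg_left (hha x) (hζ0 x)
    have h4 : a * ‖G x‖ ^ p x * η x ^ (m + 1) = ζ x * (a * ‖G x‖ ^ p x) := mul_comm _ _
    linarith
  have i5 : Integrable ((closedBall (0 : Rn n) (2 * R)).indicator (fun _ => K * C / R)) volume :=
    (integrable_indicator_iff measurableSet_closedBall).2 (integrableOn_const (hfin _))
  have hup := integral_mono i3 (hint.add i5) hpt
  rw [integral_add' hint i5, integral_indicator measurableSet_closedBall, setIntegral_const,
    smul_eq_mul, integral_const_mul] at hup
  have h6 : c * M * volume.real (closedBall (0 : Rn n) R) ≤ c * M * ∫ x, ζ x := by gcongr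
  linarith

/-! ### Nonexistence by letting the balls grow -/

lemma volume_real_closedBall_two_mul {R : ℝ} (hR : 0 ≤ R) :
    volume.real (closedBall (0 : Rn n) (2 * R)) =
      2 ^ n * volume.real (closedBall (0 : Rn n) R) := by
  rw [Measure.addHaar_real_closedBall' _ _ (by positivity : 0 ≤ 2 * R),
    Measure.addHaar_real_closedBall' _ _ hR, mul_pow, mul_assoc]
  simp

/-- There are no bounded supersolutions whose right-hand side is positive. -/
theorem not_exists_bounded_supersolution {p : Rn n → ℝ} (hp : IsExponent p)
    {A : Rn n → ℝ → Rn n → Rn n} (hA : HasGrowth p A) {f : ℝ → ℝ} (hf : Continuous f)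
    (hf0 : ∀ t, 0 < f t) :
    ¬ ∃ u : Rn n → ℝ, IsSupersolution p A f u ∧
      ∃ M : ℝ, ∀ᵐ x ∂(volume : Measure (Rn n)), |u x| ≤ M := by
  rintro ⟨u, ⟨G, hu, hsup⟩, M', hM'⟩
  obtain ⟨hcar, a, b, -, -, ⟨a₀, ha₀, haa⟩, hab, ⟨b₁, hb₁⟩, hAa, hAb⟩ := hA
  -- Enlarging the bound ensures cM > 0.
  set M := max M' 1
  have hM1 : 1 ≤ M := le_max_right _ _
  have hM : ∀ᵐ x ∂(volume : Measure (Rn n)), |u x| ≤ M :=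
    hM'.mono fun x hx => hx.trans (le_max_left _ _)
  obtain ⟨t₀, -, ht₀⟩ := isCompact_Icc.exists_isMinOn
    (Set.nonempty_Icc.2 (by linarith : -M ≤ M)) hf.continuousOn
  set c := f t₀
  have hc : 0 < c := hf0 t₀
  have hcf : ∀ᵐ x ∂(volume : Measure (Rn n)), c ≤ f (u x) := by
    filter_upwards [hM] with x hx using ht₀ (abs_le.1 hx)
  have hb : 0 ≤ b₁ := by linarith [haa 0, hab 0, hb₁ 0]
  have hm : AEStronglyMeasurable (fun x => A x (u x) (G x)) volume :=
    (aemeasurable_caratheodory (B := fun x (q : ℝ × Rn n) => A x q.1 q.2)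
      (fun q => hcar.1 q.1 q.2) hcar.2 (hu.1.1.aestronglyMeasurable.aemeasurable.prodMk
        hu.1.2.1.aestronglyMeasurable.aemeasurable)).aestronglyMeasurable
  obtain ⟨K, hK0, hK⟩ := exists_mul_measure_le (f := f) hp hu hm ha₀ hb
    (fun x => le_trans (by gcongr; exact haa x) (hAa x (u x) (G x)))
    (fun x => (hAb x (u x) (G x)).trans (by gcongr; exact hb₁ x))
    hc.le (by linarith) hM hcf (fun φ hφ hφ0 => (hsup φ hφ hφ0).2)
  have hcM : 0 < c * M := by positivity
  -- The first summand, with the extra 1, contradicts cM ≤ 2ⁿK/R; the second ensures K/R ≤ a₀.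
  set R := K * 2 ^ n / (c * M) + K / a₀ + 1
  have h1 : 0 ≤ K * 2 ^ n / (c * M) := by positivity
  have h2 : 0 ≤ K / a₀ := by positivity
  have hR : 0 < R := by positivity
  have hRa : K / R ≤ a₀ := by
    rw [div_le_comm₀ hR ha₀]
    linarith
  have h3 := hK R hR hRa
  rw [volume_real_closedBall_two_mul hR.le, ← mul_assoc] at h3
  have hV : 0 < volume.real (closedBall (0 : Rn n) R) :=
    ENNReal.toReal_pos (measure_closedBall_pos _ _ hR).ne' measure_closedBall_lt_top.ne
  have h4 := le_of_mul_le_mul_right h3 hV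
  rw [div_mul_eq_mul_div, le_div_iff₀ hR] at h4
  have h5 : K * 2 ^ n / (c * M) < R := by linarith
  rw [div_lt_iff₀ hcM] at h5
  linarith

end NonstandardGrowth

theorem corollary4p5 (n : ℕ)
    (p : NonstandardGrowth.Rn n → ℝ) (hp : NonstandardGrowth.IsExponent p)
    (hpn : (n : ℝ) < NonstandardGrowth.expInf p)
    (A : NonstandardGrowth.Rn n → ℝ → NonstandardGrowth.Rn n → NonstandardGrowth.Rn n)
    (hA : NonstandardGrowth.HasGrowth p A)
    (f : ℝ → ℝ) (hf_cont : Continuous f) (hf_nonneg : ∀ t, 0 ≤ f t)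
    (hf_conv : StrictConvexOn ℝ Set.univ f) (hf_ne : ∀ t, f t ≠ 0) :
    ¬ ∃ u : NonstandardGrowth.Rn n → ℝ,
      NonstandardGrowth.IsSupersolution p A f u ∧
      ∃ M : ℝ, ∀ᵐ x ∂(volume : Measure (NonstandardGrowth.Rn n)), |u x| ≤ M :=
  NonstandardGrowth.not_exists_bounded_supersolution hp hA hf_cont fun t =>
    lt_of_le_of_ne (hf_nonneg t) (hf_ne t).symm
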